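/- **Theorem (Connection with the Local Time).** Let $1/2<H<1$ and $\alpha_H=H(2H-1)$. Let $f:\mathbb R^d\to[0,\infty]$ be a measurable, locally integrable function which is the Fourier transform, in the space of tempered distributions, of a tempered measure $\mu$, i.e. $\int f(x)\varphi(x)\,dx=\int \mathcal F\varphi(\xi)\,\mu(d\xi)$ for all Schwartz functions $\varphi$, where $\mathcal F\varphi(\xi)=\int e^{-i\xi\cdot x}\varphi(x)\,dx$. Let $X=(X_t)_{t\ge0}$ be a $d$-dimensional Lévy process (with $X_0=0$) such that the law of $X_t$ has a density for every $t>0$. Let $\bar X=X-\tilde X$, where $\tilde X$ is an independent copy of $X$, let $(\bar P_t\phi)(x)=E[\phi(x+\bar X_t)]$ be the semigroup of $\bar X$, and for $\alpha>0$ and measurable $\phi:\mathbb R^d\to[0,\infty]$ put $$(\bar R_{\alpha,H}\phi)(x)=\alpha_H\int_0^\infty\!\int_0^\infty |r-s|^{2H-2}e^{-\alpha(r+s)}(\bar P_{r+s}\phi)(x)\,dr\,ds .$$ Suppose that $f(x)<\infty$ if and only if $x\neq0$, and that $(\bar R_{\alpha,H}f)(0)<\infty$ for all $\alpha>0$. Let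 $x_1,x_2\in\mathbb R^d$, let $\bar X^1,\bar X^2$ be independent processes with càdlàg paths such that $\bar X^i$ has the law of $x_i+\bar X$, and let $$L_{t,H}(f)=\alpha_H\int_0^t\!\int_0^t|r-s|^{2H-2}f(\bar X^1_r-\bar X^2_s)\,dr\,ds,\qquad t>0 .$$ Then almost surely $L_{t,H}(f)<\infty$ for all $t>0$, and almost surely $\limsup_{t\to\infty}\frac{\log L_{t,H}(f)}{t}\le0$ (with $\log 0=-\infty$). -/

import Mathlib

open MeasureTheory ProbabilityTheory Filter Topology
open scoped ENNReal NNReal SchwartzMap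

/-- Almost every path is right-continuous with left limits. -/
def HasCadlagPaths {Ω E : Type*} [MeasurableSpace Ω] [TopologicalSpace E]
    (X : ℝ≥0 → Ω → E) (P : Measure Ω) : Prop :=
  ∀ᵐ ω ∂P, ∀ t : ℝ≥0,
    ContinuousWithinAt (fun s => X s ω) (Set.Ici t) t ∧
      ∃ l : E, Tendsto (fun s => X s ω) (𝓝[<] t) (𝓝 l)

/-- A Lévy process: it starts at `0`, has independent and stationary increments, and almost all of
its paths are right-continuous with left limits (so it is continuous in probability). -/
structure IsLevyProcess {Ω E : Type*} [MeasurableSpace Ω] [NormedAddCommGroup E]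
    [MeasurableSpace E] (X : ℝ≥0 → Ω → E) (P : Measure Ω) : Prop where
  measurable : ∀ t, Measurable (X t)
  start_zero : ∀ᵐ ω ∂P, X 0 ω = 0
  indep_increments : HasIndepIncrements X P
  stationary_increments :
    ∀ s t, IdentDistrib (fun ω => X (s + t) ω - X s ω) (X t) P P
  cadlag : HasCadlagPaths X P

/-- `Y`, defined on `(Ω', P')`, is a copy of the process `X`, defined on `(Ω, P)`: the two
processes have the same law on the space of paths, and `Y` has càdlàg paths. -/
structure IsProcessCopy {Ω' Ω E : Type*} [MeasurableSpace Ω'] [MeasurableSpace Ω]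
    [TopologicalSpace E] [MeasurableSpace E]
    (Y : ℝ≥0 → Ω' → E) (P' : Measure Ω') (X : ℝ≥0 → Ω → E) (P : Measure Ω) : Prop where
  measurable : ∀ t, Measurable (Y t)
  law_eq : IdentDistrib (fun ω t => Y t ω) (fun ω t => X t ω) P' P
  cadlag : HasCadlagPaths Y P'

/-- Two processes on the same probability space are independent. -/
def IndepProcesses {Ω E : Type*} [MeasurableSpace Ω] [MeasurableSpace E]
    (X Y : ℝ≥0 → Ω → E) (P : Measure Ω) : Prop :=
  IndepFun (fun ω t => X t ω) (fun ω t => Y t ω) P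

/-- The Fourier transform `ξ ↦ ∫ e^{-i ξ·x} φ(x) dx`. -/
noncomputable def fourierInt {d : ℕ} (φ : EuclideanSpace ℝ (Fin d) → ℂ)
    (ξ : EuclideanSpace ℝ (Fin d)) : ℂ :=
  ∫ x, Complex.exp (-Complex.I * ((inner ℝ ξ x : ℝ) : ℂ)) * φ x

/-- `f : ℝ^d → [0, ∞]` is a measurable, locally integrable function which, as a tempered
distribution, is the Fourier transform of the tempered measure `μ`. -/
structure IsCovarianceKernel {d : ℕ} (f : EuclideanSpace ℝ (Fin d) → ℝ≥0∞)
    (μ : Measure (EuclideanSpace ℝ (Fin d))) : Prop where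
  measurable : Measurable f
  locally_integrable : ∀ K : Set (EuclideanSpace ℝ (Fin d)), IsCompact K → ∫⁻ x in K, f x < ∞
  tempered : μ.HasTemperateGrowth
  integrable_mul : ∀ φ : 𝓢(EuclideanSpace ℝ (Fin d), ℂ),
    Integrable (fun x => ((f x).toReal : ℂ) * φ x)
  fourier_eq : ∀ φ : 𝓢(EuclideanSpace ℝ (Fin d), ℂ),
    ∫ x, ((f x).toReal : ℂ) * φ x = ∫ ξ, fourierInt φ ξ ∂μ

/-- The constant `α_H = H (2H - 1)`. -/
def hurstConst (H : ℝ) : ℝ := H * (2 * H - 1)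

/-- The weight `α_H |r - s|^{2H-2}`; its value on the null set `r = s` plays no role. -/
noncomputable def hurstWeight (H r s : ℝ) : ℝ≥0∞ :=
  ENNReal.ofReal (hurstConst H * |r - s| ^ (2 * H - 2))

/-- The semigroup `(P_t φ)(x) = E[φ(x + Z_t)]` of a Lévy process `Z` started at `0`, for
`φ : ℝ^d → [0, ∞]`. -/
noncomputable def levySemigroup {Ω E : Type*} [MeasurableSpace Ω] [Add E]
    (Z : ℝ≥0 → Ω → E) (P : Measure Ω) (t : ℝ≥0) (φ : E → ℝ≥0∞) (x : E) : ℝ≥0∞ :=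
  ∫⁻ ω, φ (x + Z t ω) ∂P

/-- The fractional resolvent
`(R_{a,H} φ)(x) = α_H ∫_0^∞ ∫_0^∞ |r - s|^{2H-2} e^{-a(r+s)} (P_{r+s} φ)(x) dr ds`,
where `(P_t)` is the semigroup of `Z`. -/
noncomputable def fracResolvent {Ω E : Type*} [MeasurableSpace Ω] [Add E]
    (Z : ℝ≥0 → Ω → E) (P : Measure Ω) (H a : ℝ) (φ : E → ℝ≥0∞) (x : E) : ℝ≥0∞ :=
  ∫⁻ s in Set.Ioi (0 : ℝ), ∫⁻ r in Set.Ioi (0 : ℝ),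
    hurstWeight H r s * ENNReal.ofReal (Real.exp (-a * (r + s))) *
      levySemigroup Z P (r + s).toNNReal φ x

/-- The weighted intersection local time
`L_{t,H}(f) = α_H ∫_0^t ∫_0^t |r - s|^{2H-2} f(Y¹_r - Y²_s) dr ds`, pathwise. -/
noncomputable def weightedLocalTime {Ω E : Type*} [Sub E] (H : ℝ) (f : E → ℝ≥0∞)
    (Y₁ Y₂ : ℝ≥0 → Ω → E) (t : ℝ) (ω : Ω) : ℝ≥0∞ :=
  ∫⁻ s in Set.Ioc (0 : ℝ) t, ∫⁻ r in Set.Ioc (0 : ℝ) t,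
    hurstWeight H r s * f (Y₁ r.toNNReal ω - Y₂ s.toNNReal ω)

/-! Write φ_t for the characteristic function of X_t. That of X̄_t is |φ_t|², which is real and
multiplicative in t, so X̄¹_r - X̄²_s has the law of (x₁ - x₂) + X̄_{r+s}
(`map_sub_eq_map_symmetrization`). Hence E f(X̄¹_r - X̄²_s) = (P̄_{r+s} f)(x₁ - x₂).

The starting points are removed by positive definiteness: (P̄_t f)(x) ≤ (P̄_t f)(0). If p is the
density of X_t, then (P̄_t f)(x) = ∫∫ f(x + y - z) p(y) p(z) dy dz, formally ∫ e^{-iξ·x} |p̂(ξ)|²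
μ(dξ), which is largest at x = 0 because μ is positive. The Fourier identity holds only against
Schwartz functions, so the inequality is proved for smooth compactly supported p, then for bounded
compactly supported p by mollification, and finally for all p by truncation and Fatou
(`corrForm_le`).

As r + s ≤ 2t on the domain of integration, it follows that E L_t ≤ e^{2at} (R̄_{a,H} f)(0) for
every a > 0 (`lintegral_weightedLocalTime_le`). This gives finiteness at integer times; summing
e^{-3an} L_n gives L_n ≤ e^{3an} eventually, almost surely. Monotonicity of L in t passes to real
times, and a runs through 1/(k+1). -/

namespace IntersectionLocalTime

open scoped Convolution

/-- The correlation form `∫∫ f(x + (y - z)) p(y) p(z) dy dz`. -/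
noncomputable def corrForm {d : ℕ} (f : EuclideanSpace ℝ (Fin d) → ℝ≥0∞)
    (x : EuclideanSpace ℝ (Fin d)) (p : EuclideanSpace ℝ (Fin d) → ℝ≥0∞) : ℝ≥0∞ :=
  ∫⁻ q : EuclideanSpace ℝ (Fin d) × EuclideanSpace ℝ (Fin d),
    f (x + (q.1 - q.2)) * (p q.1 * p q.2)

/-- The autocorrelation `w ↦ ∫ u(-t) u(w - t) dt`. -/
noncomputable def autocorr {d : ℕ} (u : EuclideanSpace ℝ (Fin d) → ℝ) :
    EuclideanSpace ℝ (Fin d) → ℝ :=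
  (fun t => u (-t)) ⋆[ContinuousLinearMap.mul ℝ ℝ] u

/-! ### Positive definiteness: the correlation form is largest at the origin -/

section CorrelationForm

variable {d : ℕ} {f : EuclideanSpace ℝ (Fin d) → ℝ≥0∞}
  {μ : Measure (EuclideanSpace ℝ (Fin d))}

/-- The substitution w = x + y - z puts `f` against a single translated test function, to which the
Fourier hypothesis can apply. -/
theorem corrForm_ofReal (hf : Measurable f) {u : EuclideanSpace ℝ (Fin d) → ℝ}
    (hu : Continuous u) (hc : HasCompactSupport u) (h0 : ∀ y, 0 ≤ u y)
    (x : EuclideanSpace ℝ (Fin d)) :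
    corrForm f x (fun y => ENNReal.ofReal (u y)) =
      ∫⁻ w, f w * ENNReal.ofReal (autocorr u (w - x)) := by
  have hum := hu.measurable
  have h1 (w : EuclideanSpace ℝ (Fin d)) :
      ∫⁻ z, ENNReal.ofReal (u (w + (z - x))) * ENNReal.ofReal (u z) =
        ENNReal.ofReal (autocorr u (w - x)) := by
    rw [← lintegral_neg_eq_self]
    have hint : Integrable (fun t => u (-t) * u (w - x - t)) := by
      apply Continuous.integrable_of_hasCompactSupport (by fun_prop)
      exact (hc.comp_homeomorph (Homeomorph.neg _)).mul_right
    simp only [autocorr, convolution_def, ContinuousLinearMap.mul_apply']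
    rw [ofReal_integral_eq_lintegral_ofReal hint
      (ae_of_all _ fun t => mul_nonneg (h0 _) (h0 _))]
    refine lintegral_congr fun t => ?_
    rw [ENNReal.ofReal_mul (h0 _), mul_comm]
    congr 3
    abel
  unfold corrForm
  rw [Measure.volume_eq_prod, lintegral_prod_symm _ (by fun_prop)]
  have h2 (z : EuclideanSpace ℝ (Fin d)) :
      ∫⁻ y, f (x + (y - z)) * (ENNReal.ofReal (u y) * ENNReal.ofReal (u z)) =
      ∫⁻ w, f w * (ENNReal.ofReal (u (w + (z - x))) * ENNReal.ofReal (u z)) := by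
    rw [← lintegral_add_right_eq_self _ (z - x)]
    refine lintegral_congr fun w => ?_
    congr 2
    abel
  simp_rw [h2]
  rw [lintegral_lintegral_swap (by fun_prop)]
  refine lintegral_congr fun w => ?_
  rw [lintegral_const_mul _ (by fun_prop), h1]

/-- Convolving with the reflection multiplies û by its conjugate, whence a nonnegative transform;
translation contributes only a phase. -/
theorem fourierInt_autocorr {u : EuclideanSpace ℝ (Fin d) → ℝ}
    (hu : Continuous u) (hc : HasCompactSupport u) (x ξ : EuclideanSpace ℝ (Fin d)) :
    fourierInt (fun w => (autocorr u (w - x) : ℂ)) ξ =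
      Complex.exp (-Complex.I * ((inner ℝ ξ x : ℝ) : ℂ)) *
        ((Complex.normSq (fourierInt (fun w => (u w : ℂ)) ξ) : ℝ) : ℂ) := by
  set e : EuclideanSpace ℝ (Fin d) → ℂ :=
    fun w => Complex.exp (-Complex.I * ((inner ℝ ξ w : ℝ) : ℂ)) with he
  have hec : Continuous e := by fun_prop
  have hadd (a b : EuclideanSpace ℝ (Fin d)) : e (a + b) = e a * e b := by
    simp only [he, inner_add_right, Complex.ofReal_add, mul_add, Complex.exp_add]
  have hi1 : Integrable (fun t => e t * (u t : ℂ)) := by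
    apply Continuous.integrable_of_hasCompactSupport (by fun_prop)
    exact (hc.comp_left (g := fun r : ℝ => (r : ℂ)) (by simp)).mul_left
  have hi2 : Integrable (fun t => e t * (u (-t) : ℂ)) := by
    apply Continuous.integrable_of_hasCompactSupport (by fun_prop)
    exact ((hc.comp_homeomorph (Homeomorph.neg _)).comp_left
      (g := fun r : ℝ => (r : ℂ)) (by simp)).mul_left
  have h1 : ∫ w, e w * (autocorr u w : ℂ) =
      (∫ t, e t * (u (-t) : ℂ)) * ∫ t, e t * (u t : ℂ) := by
    have := integral_convolution (L := ContinuousLinearMap.mul ℂ ℂ) hi2 hi1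
    rw [ContinuousLinearMap.mul_apply'] at this
    rw [← this]
    refine integral_congr_ae (ae_of_all _ fun w => ?_)
    simp only [autocorr, convolution_def, ContinuousLinearMap.mul_apply']
    rw [← integral_complex_ofReal, ← integral_const_mul]
    refine integral_congr_ae (ae_of_all _ fun t => ?_)
    have : e w = e t * e (w - t) := by rw [← hadd]; congr 1; abel
    simp only [this, Complex.ofReal_mul]
    ring
  have h2 : ∫ t, e t * (u (-t) : ℂ) = (starRingEnd ℂ) (∫ t, e t * (u t : ℂ)) := by
    rw [← integral_conj, ← integral_neg_eq_self]
    refine integral_congr_ae (ae_of_all _ fun t => ?_)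
    simp [he, ← Complex.exp_conj]
  have h3 : fourierInt (fun w => (autocorr u (w - x) : ℂ)) ξ =
      e x * ∫ w, e w * (autocorr u w : ℂ) := by
    unfold fourierInt
    rw [← integral_sub_right_eq_self (fun w => e w * (autocorr u w : ℂ)) x, ← integral_const_mul]
    refine integral_congr_ae (ae_of_all _ fun t => ?_)
    have : e t = e x * e (t - x) := by rw [← hadd]; congr 1; abel
    change e t * _ = _
    simp only [this]
    ring
  rw [h3, h1, h2, Complex.normSq_eq_conj_mul_self]
  rfl

theorem corrForm_le_of_smooth (hf : IsCovarianceKernel f μ) {u : EuclideanSpace ℝ (Fin d) → ℝ}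
    (hu : ContDiff ℝ (⊤ : ℕ∞) u) (hc : HasCompactSupport u) (h0 : ∀ y, 0 ≤ u y)
    (hfin : ∀ᵐ y, f y < ∞) (x : EuclideanSpace ℝ (Fin d)) :
    corrForm f x (fun y => ENNReal.ofReal (u y)) ≤
      corrForm f 0 (fun y => ENNReal.ofReal (u y)) := by
  have hcv : HasCompactSupport (autocorr u) :=
    HasCompactSupport.convolution _ (hc.comp_homeomorph (Homeomorph.neg _)) hc
  have hsv : ContDiff ℝ (⊤ : ℕ∞) (autocorr u) := by
    apply HasCompactSupport.contDiff_convolution_right _ hc _ hu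
    exact (hu.continuous.comp continuous_neg).locallyIntegrable
  have hnn (w : EuclideanSpace ℝ (Fin d)) : 0 ≤ autocorr u w := by
    simp only [autocorr, convolution_def, ContinuousLinearMap.mul_apply']
    exact integral_nonneg fun t => mul_nonneg (h0 _) (h0 _)
  have key (x : EuclideanSpace ℝ (Fin d)) :
      ∃ φ : 𝓢(EuclideanSpace ℝ (Fin d), ℂ), ∀ w, φ w = (autocorr u (w - x) : ℂ) := by
    have h1 : HasCompactSupport (fun w => (autocorr u (w - x) : ℂ)) :=
      (hcv.comp_homeomorph (Homeomorph.subRight x)).comp_left (g := fun r : ℝ => (r : ℂ)) (by simp)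
    have h2 : ContDiff ℝ (⊤ : ℕ∞) (fun w => (autocorr u (w - x) : ℂ)) :=
      Complex.ofRealCLM.contDiff.comp (hsv.comp (contDiff_id.sub contDiff_const))
    exact ⟨h1.toSchwartzMap h2, fun w => rfl⟩
  have hreal (x : EuclideanSpace ℝ (Fin d)) :
      corrForm f x (fun y => ENNReal.ofReal (u y)) =
        ENNReal.ofReal (∫ w, (f w).toReal * autocorr u (w - x)) := by
    obtain ⟨φ, hφ⟩ := key x
    have hi := hf.integrable_mul φ
    simp_rw [hφ, ← Complex.ofReal_mul] at hi
    have hi' : Integrable (fun w => (f w).toReal * autocorr u (w - x)) := by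
      simpa using hi.re
    rw [corrForm_ofReal hf.measurable hu.continuous hc h0,
      ofReal_integral_eq_lintegral_ofReal hi'
        (ae_of_all _ fun w => mul_nonneg ENNReal.toReal_nonneg (hnn _))]
    -- `toReal` sends ∞ to 0, but `f` is infinite only on a null set.
    refine lintegral_congr_ae ?_
    filter_upwards [hfin] with w hw
    rw [ENNReal.ofReal_mul ENNReal.toReal_nonneg, ENNReal.ofReal_toReal hw.ne]
  have hfour (x : EuclideanSpace ℝ (Fin d)) :
      ((∫ w, (f w).toReal * autocorr u (w - x) : ℝ) : ℂ) =
        ∫ ξ, Complex.exp (-Complex.I * ((inner ℝ ξ x : ℝ) : ℂ)) *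
          ((Complex.normSq (fourierInt (fun w => (u w : ℂ)) ξ) : ℝ) : ℂ) ∂μ := by
    obtain ⟨φ, hφ⟩ := key x
    have h := hf.fourier_eq φ
    have hφ' : (φ : EuclideanSpace ℝ (Fin d) → ℂ) = fun w => (autocorr u (w - x) : ℂ) :=
      funext hφ
    rw [hφ'] at h
    simp_rw [fourierInt_autocorr hu.continuous hc, ← Complex.ofReal_mul] at h
    rw [← h, integral_complex_ofReal]
  rw [hreal x, hreal 0]
  refine ENNReal.ofReal_le_ofReal ?_
  have h0' := hfour 0
  simp only [inner_zero_right, Complex.ofReal_zero, mul_zero, Complex.exp_zero, one_mul] at h0'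
  rw [integral_complex_ofReal] at h0'
  rw [Complex.ofReal_injective h0']
  calc _ ≤ ‖((∫ w, (f w).toReal * autocorr u (w - x) : ℝ) : ℂ)‖ := by
        rw [Complex.norm_real]; exact le_abs_self _
    _ ≤ _ := by
      rw [hfour x]
      -- The phase has modulus 1, so the norm of the integrand is |û|², the integrand at x = 0.
      refine (norm_integral_le_integral_norm _).trans (le_of_eq ?_)
      refine integral_congr_ae (ae_of_all _ fun ξ => ?_)
      simp only [norm_mul, Complex.norm_real, Real.norm_eq_abs,
        abs_of_nonneg (Complex.normSq_nonneg _)]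
      rw [Complex.norm_exp]
      simp

theorem ae_lt_top_of_isCovarianceKernel (hf : IsCovarianceKernel f μ) : ∀ᵐ y, f y < ∞ := by
  have h (n : ℕ) : ∀ᵐ y, y ∈ Metric.closedBall (0 : EuclideanSpace ℝ (Fin d)) n → f y < ∞ := by
    rw [← ae_restrict_iff' Metric.isClosed_closedBall.measurableSet]
    exact ae_lt_top hf.measurable (hf.locally_integrable _ (isCompact_closedBall _ _)).ne
  filter_upwards [ae_all_iff.2 h] with y hy
  obtain ⟨n, hn⟩ := exists_nat_ge ‖y‖
  exact hy n (by simpa using hn)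

/-- Continuity of the correlation form along dominated sequences. -/
theorem tendsto_corrForm (hf : IsCovarianceKernel f μ) {M R : ℝ}
    {p : EuclideanSpace ℝ (Fin d) → ℝ} {u : ℕ → EuclideanSpace ℝ (Fin d) → ℝ}
    (hum : ∀ n, Measurable (u n)) (huM : ∀ n y, u n y ≤ M)
    (huR : ∀ n y, R < ‖y‖ → u n y = 0)
    (hlim : ∀ᵐ y, Tendsto (fun n => u n y) atTop (𝓝 (p y))) (x : EuclideanSpace ℝ (Fin d)) :
    Tendsto (fun n => corrForm f x (fun y => ENNReal.ofReal (u n y))) atTop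
      (𝓝 (corrForm f x (fun y => ENNReal.ofReal (p y)))) := by
  have hfm := hf.measurable
  set B := Metric.closedBall (0 : EuclideanSpace ℝ (Fin d)) R with hB
  have hBm : MeasurableSet B := Metric.isClosed_closedBall.measurableSet
  set b : EuclideanSpace ℝ (Fin d) → ℝ≥0∞ := B.indicator fun _ => ENNReal.ofReal M with hb
  have hbm : Measurable b := measurable_const.indicator hBm
  have hub (n y) : ENNReal.ofReal (u n y) ≤ b y := by
    by_cases hy : y ∈ B
    · rw [hb, Set.indicator_of_mem hy]
      exact ENNReal.ofReal_le_ofReal (huM n y)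
    · rw [huR n y (by simpa [hB] using hy)]
      simp
  refine tendsto_lintegral_of_dominated_convergence
    (fun q => f (x + (q.1 - q.2)) * (b q.1 * b q.2)) (fun n => by have := hum n; fun_prop)
    (fun n => ae_of_all _ fun q => mul_le_mul_right (mul_le_mul' (hub _ _) (hub _ _)) _) ?_ ?_
  · rw [Measure.volume_eq_prod, lintegral_prod_symm _ (by fun_prop)]
    -- With y and z in the ball of radius R, the argument x + y - z stays in this compact ball,
    -- where `f` is integrable.
    set C := Metric.closedBall (0 : EuclideanSpace ℝ (Fin d)) (‖x‖ + R + R) with hC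
    have hCm : MeasurableSet C := Metric.isClosed_closedBall.measurableSet
    have h1 (z : EuclideanSpace ℝ (Fin d)) : ∫⁻ y, f (x + (y - z)) * (b y * b z) ≤
        (∫⁻ w in C, f w) * (ENNReal.ofReal M * b z) := by
      by_cases hz : z ∈ B
      swap
      · simp [hb, hz]
      rw [← lintegral_add_right_eq_self _ (z - x), ← lintegral_indicator hCm,
        ← lintegral_mul_const _ (hfm.indicator hCm)]
      refine lintegral_mono fun w => ?_
      have hw : x + (w + (z - x) - z) = w := by abel
      simp only [hw]
      by_cases hwB : w + (z - x) ∈ B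
      · have hwC : w ∈ C := by
          simp only [hC, hB, Metric.mem_closedBall, dist_zero_right] at hwB hz ⊢
          have : w = x + (w + (z - x)) - z := by abel
          rw [this]
          refine (norm_sub_le _ _).trans ?_
          have := norm_add_le x (w + (z - x))
          linarith
        rw [Set.indicator_of_mem hwC]
        gcongr
        rw [hb, Set.indicator_of_mem hwB]
      · simp [hb, hwB]
    refine ne_top_of_le_ne_top ?_ (lintegral_mono h1)
    rw [lintegral_const_mul _ (by fun_prop), lintegral_const_mul _ hbm, hb,
      lintegral_indicator_const hBm]
    have := (hf.locally_integrable C (isCompact_closedBall _ _)).ne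
    have : volume B ≠ ∞ := (isCompact_closedBall _ _).measure_ne_top
    finiteness
  · have hlim2 : ∀ᵐ q : EuclideanSpace ℝ (Fin d) × EuclideanSpace ℝ (Fin d),
        Tendsto (fun n => u n q.1) atTop (𝓝 (p q.1)) ∧
        Tendsto (fun n => u n q.2) atTop (𝓝 (p q.2)) :=
      (Measure.quasiMeasurePreserving_fst.ae hlim).and
        (Measure.quasiMeasurePreserving_snd.ae hlim)
    have hfin : ∀ᵐ q : EuclideanSpace ℝ (Fin d) × EuclideanSpace ℝ (Fin d),
        f (x + (q.1 - q.2)) < ∞ := by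
      have hq : Measure.QuasiMeasurePreserving
          (fun q : EuclideanSpace ℝ (Fin d) × EuclideanSpace ℝ (Fin d) => q.1 - q.2)
          (volume.prod volume) volume := quasiMeasurePreserving_sub_of_right_invariant _ _
      exact ((measurePreserving_add_left volume x).quasiMeasurePreserving.comp hq).ae
        (ae_lt_top_of_isCovarianceKernel hf)
    filter_upwards [hlim2, hfin] with q hq hqf
    refine ENNReal.Tendsto.const_mul ?_ (Or.inr hqf.ne)
    exact ENNReal.Tendsto.mul (ENNReal.tendsto_ofReal hq.1) (Or.inr ENNReal.ofReal_ne_top)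
      (ENNReal.tendsto_ofReal hq.2) (Or.inr ENNReal.ofReal_ne_top)

theorem corrForm_le_of_bounded (hf : IsCovarianceKernel f μ) {M R : ℝ}
    {p : EuclideanSpace ℝ (Fin d) → ℝ} (hp : Measurable p) (h0 : ∀ y, 0 ≤ p y)
    (hM : ∀ y, p y ≤ M) (hR : ∀ y, R < ‖y‖ → p y = 0) (x : EuclideanSpace ℝ (Fin d)) :
    corrForm f x (fun y => ENNReal.ofReal (p y)) ≤
      corrForm f 0 (fun y => ENNReal.ofReal (p y)) := by
  have hcp : HasCompactSupport p :=
    HasCompactSupport.intro (isCompact_closedBall 0 R) fun y hy => hR y (by simpa using hy)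
  have hint : Integrable p := by
    rw [← integrableOn_iff_integrable_of_support_subset (s := Metric.closedBall 0 R)]
    · refine Measure.integrableOn_of_bounded (M := M)
        (isCompact_closedBall _ _).measure_ne_top hp.aestronglyMeasurable
        (ae_of_all _ fun y => ?_)
      rw [Real.norm_of_nonneg (h0 y)]
      exact hM y
    · intro y hy
      by_contra h
      exact hy (hR y (by simpa using h))
  -- The fixed ratio 2 of outer to inner radius gives almost everywhere convergence of the
  -- mollifications; outer radius at most 2 explains the support bound R + 2 below.
  let φ (n : ℕ) : ContDiffBump (0 : EuclideanSpace ℝ (Fin d)) :=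
    ⟨1 / ((n : ℝ) + 1), 2 * (1 / ((n : ℝ) + 1)), by positivity,
      lt_two_mul_self (by positivity)⟩
  let u (n : ℕ) : EuclideanSpace ℝ (Fin d) → ℝ :=
    (φ n).normed volume ⋆[ContinuousLinearMap.lsmul ℝ ℝ] p
  have hu (n y) : u n y = ∫ t, (φ n).normed volume t * p (y - t) := rfl
  have hsm (n) : ContDiff ℝ (⊤ : ℕ∞) (u n) :=
    (φ n).hasCompactSupport_normed.contDiff_convolution_left _ (φ n).contDiff_normed
      hint.locallyIntegrable
  have hcs (n) : HasCompactSupport (u n) :=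
    HasCompactSupport.convolution _ (φ n).hasCompactSupport_normed hcp
  have hnn (n y) : 0 ≤ u n y := by
    rw [hu]
    exact integral_nonneg fun t => mul_nonneg ((φ n).nonneg_normed t) (h0 _)
  have hM' (n y) : u n y ≤ M := by
    rw [hu]
    calc _ ≤ ∫ t, (φ n).normed volume t * M := by
          refine integral_mono_of_nonneg
            (ae_of_all _ fun t => mul_nonneg ((φ n).nonneg_normed t) (h0 _))
            ((φ n).integrable_normed.mul_const M) (ae_of_all _ fun t => ?_)
          exact mul_le_mul_of_nonneg_left (hM _) ((φ n).nonneg_normed t)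
      _ = M := by rw [integral_mul_const, (φ n).integral_normed, one_mul]
  have hR' (n y) (hy : R + 2 < ‖y‖) : u n y = 0 := by
    rw [hu]
    refine integral_eq_zero_of_ae (ae_of_all _ fun t => ?_)
    by_cases ht : t ∈ Metric.ball (0 : EuclideanSpace ℝ (Fin d)) (φ n).rOut
    · have h1 : ‖t‖ < 2 * (1 / ((n : ℝ) + 1)) := mem_ball_zero_iff.1 ht
      have h2 : 1 / ((n : ℝ) + 1) ≤ 1 := by
        rw [div_le_one (by positivity)]
        linarith [n.cast_nonneg (α := ℝ)]
      have h3 := norm_sub_norm_le y t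
      simp [hR (y - t) (by linarith)]
    · rw [← (φ n).support_normed_eq (μ := volume), Function.notMem_support] at ht
      simp [ht]
  have hlim : ∀ᵐ y, Tendsto (fun n => u n y) atTop (𝓝 (p y)) := by
    refine ContDiffBump.ae_convolution_tendsto_right_of_locallyIntegrable (K := 2) ?_
      (Eventually.of_forall fun n => le_rfl) hint.locallyIntegrable
    have := (tendsto_one_div_add_atTop_nhds_zero_nat (𝕜 := ℝ)).const_mul 2
    simpa only [mul_zero] using this
  have ht := tendsto_corrForm hf (fun n => (hsm n).continuous.measurable) hM' hR' hlim
  exact le_of_tendsto_of_tendsto' (ht x) (ht 0) fun n =>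
    corrForm_le_of_smooth hf (hsm n) (hcs n) (hnn n) (ae_lt_top_of_isCovarianceKernel hf) x

theorem corrForm_le (hf : IsCovarianceKernel f μ)
    {p : EuclideanSpace ℝ (Fin d) → ℝ} (hp : Measurable p) (h0 : ∀ y, 0 ≤ p y)
    (x : EuclideanSpace ℝ (Fin d)) :
    corrForm f x (fun y => ENNReal.ofReal (p y)) ≤
      corrForm f 0 (fun y => ENNReal.ofReal (p y)) := by
  have hfm := hf.measurable
  let q (n : ℕ) : EuclideanSpace ℝ (Fin d) → ℝ :=
    (Metric.closedBall 0 (n : ℝ)).indicator fun y => min (p y) n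
  have hqm (n) : Measurable (q n) :=
    (hp.min measurable_const).indicator Metric.isClosed_closedBall.measurableSet
  have hq0 (n y) : 0 ≤ q n y :=
    Set.indicator_nonneg (fun y _ => le_min (h0 y) n.cast_nonneg) y
  have hqp (n y) : q n y ≤ p y := by
    by_cases hy : y ∈ Metric.closedBall (0 : EuclideanSpace ℝ (Fin d)) (n : ℝ)
    · simp [q, Set.indicator_of_mem hy]
    · simpa [q, Set.indicator_of_notMem hy] using h0 y
  have hlim (y) : ∀ᶠ n in atTop, q n y = p y := by
    obtain ⟨N, hN⟩ := exists_nat_ge (max ‖y‖ (p y))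
    filter_upwards [eventually_ge_atTop N] with n hn
    have hn' : max ‖y‖ (p y) ≤ n := hN.trans (by exact_mod_cast hn)
    have hy : y ∈ Metric.closedBall (0 : EuclideanSpace ℝ (Fin d)) (n : ℝ) := by
      simpa using (le_max_left _ _).trans hn'
    simp only [q, Set.indicator_of_mem hy]
    exact min_eq_left ((le_max_right _ _).trans hn')
  have hn (n) : corrForm f x (fun y => ENNReal.ofReal (q n y)) ≤
      corrForm f 0 (fun y => ENNReal.ofReal (p y)) := by
    refine (corrForm_le_of_bounded hf (M := n) (R := n) (hqm n) (hq0 n) (fun y => ?_)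
      (fun y hy => Set.indicator_of_notMem (by simpa using hy) _) x).trans ?_
    · exact Set.indicator_le' (fun y _ => min_le_right _ _) (fun y _ => n.cast_nonneg) y
    · refine lintegral_mono fun y => ?_
      exact mul_le_mul_right (mul_le_mul' (ENNReal.ofReal_le_ofReal (hqp _ _))
        (ENNReal.ofReal_le_ofReal (hqp _ _))) _
  -- Fatou is needed only at x; at 0 the truncations are bounded by monotonicity.
  calc corrForm f x (fun y => ENNReal.ofReal (p y))
      ≤ liminf (fun n => corrForm f x (fun y => ENNReal.ofReal (q n y))) atTop := by
        refine le_trans (lintegral_mono fun z => ?_)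
          (lintegral_liminf_le fun n => by have := hqm n; fun_prop)
        refine le_of_eq (Tendsto.liminf_eq ?_).symm
        refine tendsto_const_nhds.congr' ?_
        filter_upwards [hlim z.1, hlim z.2] with n h1 h2
        rw [h1, h2]
    _ ≤ _ := liminf_le_of_le (by isBoundedDefault) fun b hb => by
        obtain ⟨n, h⟩ := hb.exists
        exact h.trans (hn n)

end CorrelationForm

/-! ### Laws of differences, via characteristic functions -/

theorem identDistrib_of_isProcessCopy {E Ω Ω' : Type*} [MeasurableSpace Ω] [MeasurableSpace Ω']
    [TopologicalSpace E] [MeasurableSpace E] {P : Measure Ω} {P' : Measure Ω'}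
    {Y : ℝ≥0 → Ω' → E} {X : ℝ≥0 → Ω → E} (h : IsProcessCopy Y P' X P) (t : ℝ≥0) :
    IdentDistrib (Y t) (X t) P' P :=
  h.law_eq.comp (measurable_pi_apply t)

theorem indepFun_of_indepProcesses {E Ω : Type*} [MeasurableSpace Ω] [MeasurableSpace E]
    {P : Measure Ω} {X Y : ℝ≥0 → Ω → E} (h : IndepProcesses X Y P) (s t : ℝ≥0) :
    IndepFun (X s) (Y t) P :=
  h.comp (measurable_pi_apply s) (measurable_pi_apply t)

section Law

variable {E Ω Ω' : Type*} [NormedAddCommGroup E] [InnerProductSpace ℝ E] [MeasurableSpace E]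
  [BorelSpace E] [SecondCountableTopology E] [MeasurableSpace Ω] [MeasurableSpace Ω']
  {P : Measure Ω} [IsProbabilityMeasure P] {P' : Measure Ω'} [IsProbabilityMeasure P']

theorem charFun_map_sub {X Y : Ω → E} (hX : Measurable X) (hY : Measurable Y)
    (h : IndepFun X Y P) (ξ : E) :
    charFun (P.map fun ω => X ω - Y ω) ξ =
      charFun (P.map X) ξ * (starRingEnd ℂ) (charFun (P.map Y) ξ) := by
  have h' : IndepFun X (fun ω => -Y ω) P := h.comp measurable_id measurable_neg
  have := congrFun (h'.charFun_map_fun_add_eq_mul hX.aemeasurable hY.neg.aemeasurable) ξ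
  rw [Pi.mul_apply] at this
  simp_rw [sub_eq_add_neg]
  rw [← charFun_neg]
  refine this.trans ?_
  congr 1
  have h2 := charFun_map_smul_comp (μ := P) hY.aemeasurable (-1) ξ
  simp only [neg_smul, one_smul] at h2
  exact h2

theorem charFun_map_add_of_isLevyProcess {X : ℝ≥0 → Ω → E} (hX : IsLevyProcess X P) (s t : ℝ≥0)
    (ξ : E) :
    charFun (P.map (X (s + t))) ξ = charFun (P.map (X s)) ξ * charFun (P.map (X t)) ξ := by
  have hm := hX.measurable
  have hmono : Monotone ![0, s, s + t] := by
    refine Fin.monotone_iff_le_succ.2 fun i => ?_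
    fin_cases i <;> simp
  have hi := (hX.indep_increments 2 _ hmono).indepFun (i := 0) (j := 1) (by simp)
  simp only [Fin.succ_zero_eq_one, Fin.castSucc_zero, Matrix.cons_val_zero, Matrix.cons_val_one,
    Fin.succ_one_eq_two, Matrix.cons_val, Fin.castSucc_one] at hi
  have h1 : X s - X 0 =ᵐ[P] X s := by
    filter_upwards [hX.start_zero] with ω hω
    simp [hω]
  have := congrFun (hi.charFun_map_fun_add_eq_mul ((hm _).sub (hm _)).aemeasurable
    ((hm _).sub (hm _)).aemeasurable) ξ
  rw [Pi.mul_apply, Measure.map_congr h1] at this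
  have h2 : P.map (X (s + t) - X s) = P.map (X t) := (hX.stationary_increments s t).map_eq
  rw [h2] at this
  rw [← this]
  congr 1
  refine Measure.map_congr ?_
  filter_upwards [hX.start_zero] with ω hω
  simp [hω]

variable [CompleteSpace E] {X Xtilde Xbar : ℝ≥0 → Ω → E} {Y₁ Y₂ : ℝ≥0 → Ω' → E} {x₁ x₂ : E}

/-- Subtraction conjugates the second characteristic function; |φ_s|² being real, only the phase of
x₂ changes, and φ_r φ_s = φ_{r+s} merges the times. -/
theorem map_sub_eq_map_symmetrization (hX : IsLevyProcess X P)
    (hXtilde : IsProcessCopy Xtilde P X P) (hXX : IndepProcesses X Xtilde P)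
    (hXbar : ∀ t ω, Xbar t ω = X t ω - Xtilde t ω)
    (hY₁ : IsProcessCopy Y₁ P' (fun t ω => x₁ + Xbar t ω) P)
    (hY₂ : IsProcessCopy Y₂ P' (fun t ω => x₂ + Xbar t ω) P)
    (hYY : IndepProcesses Y₁ Y₂ P') (r s : ℝ≥0) :
    P'.map (fun ω => Y₁ r ω - Y₂ s ω) = P.map (fun ω => (x₁ - x₂) + Xbar (r + s) ω) := by
  have hXbar' (t) : Xbar t = fun ω => X t ω - Xtilde t ω := funext (hXbar t)
  have hXbm (t) : Measurable (Xbar t) := by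
    rw [hXbar']
    exact (hX.measurable t).sub (hXtilde.measurable t)
  have hb (t : ℝ≥0) (ξ : E) : charFun (P.map (Xbar t)) ξ =
      charFun (P.map (X t)) ξ * (starRingEnd ℂ) (charFun (P.map (X t)) ξ) := by
    rw [hXbar', charFun_map_sub (hX.measurable t) (hXtilde.measurable t)
      (indepFun_of_indepProcesses hXX t t),
      (identDistrib_of_isProcessCopy hXtilde t).map_eq]
  have hc (x : E) (t : ℝ≥0) (ξ : E) : charFun (P.map fun ω => x + Xbar t ω) ξ =
      charFun (P.map (Xbar t)) ξ * Complex.exp (inner ℝ x ξ * Complex.I) := by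
    rw [← charFun_map_const_add, Measure.map_map (by fun_prop) (hXbm t)]
    rfl
  have := Measure.isProbabilityMeasure_map (μ := P')
    ((hY₁.measurable r).sub (hY₂.measurable s)).aemeasurable
  have := Measure.isProbabilityMeasure_map (μ := P)
    ((hXbm (r + s)).const_add (x₁ - x₂)).aemeasurable
  refine Measure.ext_of_charFun (funext fun ξ => ?_)
  have h1 := charFun_map_sub (hY₁.measurable r) (hY₂.measurable s)
    (indepFun_of_indepProcesses hYY r s) ξ
  rw [h1, (identDistrib_of_isProcessCopy hY₁ r).map_eq,
    (identDistrib_of_isProcessCopy hY₂ s).map_eq, hc, hc, hc, hb, hb, hb, charFun_map_add_of_isLevyProcess hX, inner_sub_left]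
  simp only [map_mul, Complex.conj_conj, ← Complex.exp_conj, Complex.conj_ofReal, Complex.conj_I,
    Complex.ofReal_sub, sub_mul, Complex.exp_sub, mul_neg, Complex.exp_neg]
  ring

end Law

/-! ### The semigroup of X̄ as a correlation form -/

section Semigroup

variable {d : ℕ} {Ω : Type*} [MeasurableSpace Ω] {P : Measure Ω} [IsProbabilityMeasure P]
  {f : EuclideanSpace ℝ (Fin d) → ℝ≥0∞} {μ : Measure (EuclideanSpace ℝ (Fin d))}
  {X Xtilde Xbar : ℝ≥0 → Ω → EuclideanSpace ℝ (Fin d)}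

theorem levySemigroup_eq_corrForm (hf : Measurable f) (hX : ∀ t, Measurable (X t))
    (hXtilde : IsProcessCopy Xtilde P X P) (hXX : IndepProcesses X Xtilde P)
    (hXbar : ∀ t ω, Xbar t ω = X t ω - Xtilde t ω) (t : ℝ≥0) [HasPDF (X t) P volume]
    (x : EuclideanSpace ℝ (Fin d)) :
    levySemigroup Xbar P t f x =
      corrForm f x (fun y => ENNReal.ofReal (pdf (X t) P volume y).toReal) := by
  have hm := measurable_pdf (X t) P volume
  have hmap : P.map (X t) =
      volume.withDensity (fun y => ENNReal.ofReal (pdf (X t) P volume y).toReal) := by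
    rw [map_eq_withDensity_pdf (X t) P volume]
    exact withDensity_congr_ae pdf.ofReal_toReal_ae_eq.symm
  have hprod : P.map (fun ω => (X t ω, Xtilde t ω)) = (P.map (X t)).prod (P.map (X t)) := by
    rw [(indepFun_iff_map_prod_eq_prod_map_map (hX t).aemeasurable
      (hXtilde.measurable t).aemeasurable).1 (indepFun_of_indepProcesses hXX t t),
      (identDistrib_of_isProcessCopy hXtilde t).map_eq]
  unfold levySemigroup corrForm
  simp_rw [hXbar]
  rw [← lintegral_map (f := fun q : EuclideanSpace ℝ (Fin d) × EuclideanSpace ℝ (Fin d) =>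
    f (x + (q.1 - q.2))) (by fun_prop) ((hX t).prodMk (hXtilde.measurable t)), hprod, hmap,
    prod_withDensity (by fun_prop) (by fun_prop),
    lintegral_withDensity_eq_lintegral_mul _ (by fun_prop) (by fun_prop)]
  refine lintegral_congr fun q => ?_
  rw [Pi.mul_apply, mul_comm]

theorem levySemigroup_le (hf : IsCovarianceKernel f μ) (hX : ∀ t, Measurable (X t))
    (hXtilde : IsProcessCopy Xtilde P X P) (hXX : IndepProcesses X Xtilde P)
    (hXbar : ∀ t ω, Xbar t ω = X t ω - Xtilde t ω) (t : ℝ≥0) [HasPDF (X t) P volume]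
    (x : EuclideanSpace ℝ (Fin d)) :
    levySemigroup Xbar P t f x ≤ levySemigroup Xbar P t f 0 := by
  rw [levySemigroup_eq_corrForm hf.measurable hX hXtilde hXX hXbar,
    levySemigroup_eq_corrForm hf.measurable hX hXtilde hXX hXbar]
  exact corrForm_le hf (measurable_pdf (X t) P volume).ennreal_toReal
    (fun _ => ENNReal.toReal_nonneg) x

end Semigroup

/-! ### Joint measurability of càdlàg processes -/

theorem measurable_comp_of_countable {E Ω T : Type*} [MeasurableSpace Ω] [MeasurableSpace E]
    [MeasurableSpace T] {Y : ℝ≥0 → Ω → E} (hm : ∀ t, Measurable (Y t)) (σ : ℕ → ℝ≥0) {τ : T → ℕ}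
    (hτ : Measurable τ) : Measurable fun q : T × Ω => Y (σ (τ q.1)) q.2 := by
  have h1 : Measurable fun q : ℕ × Ω => Y (σ q.1) q.2 :=
    measurable_from_prod_countable_right fun k => hm (σ k)
  exact h1.comp ((hτ.comp measurable_fst).prodMk measurable_snd)

theorem exists_countable_approx_from_right : ∃ (σ : ℕ → ℕ → ℝ≥0) (κ : ℕ → ℝ≥0 → ℕ),
    (∀ n, Measurable (κ n)) ∧ ∀ t, Tendsto (fun n => σ n (κ n t)) atTop (𝓝[≥] t) := by
  -- The grid point of mesh 1/(n+1) strictly to the right of t, at distance at most one mesh.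
  let τ (n : ℕ) (t : ℝ≥0) : ℝ≥0 := ((⌊t * (n + 1 : ℝ≥0)⌋₊ : ℝ≥0) + 1) / (n + 1)
  refine ⟨fun n k => ((k : ℝ≥0) + 1) / (n + 1), fun n t => ⌊t * (n + 1 : ℝ≥0)⌋₊,
    fun n => Nat.measurable_floor.comp (measurable_id.mul_const _), fun t => ?_⟩
  have hlow (n : ℕ) : t ≤ τ n t := by
    rw [le_div_iff₀ (by positivity)]
    exact (Nat.lt_floor_add_one _).le
  have hupp (n : ℕ) : τ n t ≤ t + 1 / ((n : ℝ≥0) + 1) := by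
    rw [div_le_iff₀ (by positivity), add_mul, one_div, inv_mul_cancel₀ (by positivity)]
    gcongr
    exact Nat.floor_le (by positivity)
  refine tendsto_nhdsWithin_iff.2 ⟨?_, Eventually.of_forall hlow⟩
  refine tendsto_of_tendsto_of_tendsto_of_le_of_le tendsto_const_nhds ?_ hlow hupp
  simpa using (tendsto_one_div_add_atTop_nhds_zero_nat (𝕜 := ℝ≥0)).const_add t

/-- Right-continuity makes the process a limit of grid-valued-time processes, off a measurable null
set where the path is made constant. -/
theorem exists_measurable_uncurry_of_hasCadlagPaths {E Ω : Type*} [MeasurableSpace Ω]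
    [TopologicalSpace E] [TopologicalSpace.PseudoMetrizableSpace E] [MeasurableSpace E]
    [BorelSpace E] [Nonempty E] {P : Measure Ω} {Y : ℝ≥0 → Ω → E} (hm : ∀ t, Measurable (Y t))
    (hc : HasCadlagPaths Y P) :
    ∃ Y' : ℝ≥0 → Ω → E, Measurable (fun q : ℝ≥0 × Ω => Y' q.1 q.2) ∧
      ∀ᵐ ω ∂P, ∀ t, Y' t ω = Y t ω := by
  classical
  obtain ⟨c⟩ := ‹Nonempty E›
  let bad : Set Ω := toMeasurable P {ω | ¬ ∀ t : ℝ≥0,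
    ContinuousWithinAt (fun s => Y s ω) (Set.Ici t) t ∧
      ∃ l : E, Tendsto (fun s => Y s ω) (𝓝[<] t) (𝓝 l)}
  have hbad : MeasurableSet bad := measurableSet_toMeasurable _ _
  have hbad0 : P bad = 0 := by rw [measure_toMeasurable]; exact hc
  have hgood (ω) (hω : ω ∉ bad) (t : ℝ≥0) : ContinuousWithinAt (fun s => Y s ω) (Set.Ici t) t := by
    have := fun h => hω (subset_toMeasurable P _ h)
    exact (not_not.1 this t).1
  obtain ⟨σ, κ, hκ, hlim⟩ := exists_countable_approx_from_right
  refine ⟨fun t ω => if ω ∈ bad then c else Y t ω, ?_, ?_⟩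
  · refine measurable_of_tendsto_metrizable
      (f := fun (n : ℕ) (q : ℝ≥0 × Ω) => if q.2 ∈ bad then c else Y (σ n (κ n q.1)) q.2)
      (fun n => Measurable.ite (measurable_snd hbad) measurable_const ?_) ?_
    · exact measurable_comp_of_countable hm (σ n) (hκ n)
    · refine tendsto_pi_nhds.2 fun q => ?_
      by_cases hq : q.2 ∈ bad
      · simp only [hq, if_true]
        exact tendsto_const_nhds
      · simp only [hq, if_false]
        exact (hgood q.2 hq q.1).tendsto.comp (hlim q.1)
  · have : ∀ᵐ ω ∂P, ω ∉ bad := measure_eq_zero_iff_ae_notMem.1 hbad0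
    filter_upwards [this] with ω hω t
    simp [hω]

/-! ### From integer times to the exponential growth rate -/

theorem limsup_log_div_le_zero {g : ℝ → ℝ≥0∞} (hg : Monotone g)
    (h : ∀ k : ℕ, ∀ᶠ n : ℕ in atTop,
      g n ≤ ENNReal.ofReal (Real.exp (3 * (1 / ((k : ℝ) + 1)) * n))) :
    limsup (fun t : ℝ => ENNReal.log (g t) / (t : EReal)) atTop ≤ 0 := by
  refine le_of_forall_gt_imp_ge_of_dense fun c hc => ?_
  obtain ⟨a, ha0, hac⟩ := EReal.lt_iff_exists_real_btwn.1 hc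
  have ha0' : 0 < a := by exact_mod_cast ha0
  -- The 6 absorbs the rate factor 3 and the bound ⌈t⌉ ≤ 2t for t ≥ 1.
  obtain ⟨k, hk⟩ := exists_nat_one_div_lt (show 0 < a / 6 by positivity)
  refine le_trans (limsup_le_of_le (by isBoundedDefault) ?_) hac.le
  filter_upwards [tendsto_nat_ceil_atTop.eventually (h k), eventually_ge_atTop 1] with t ht ht1
  have htc : (⌈t⌉₊ : ℝ) ≤ 2 * t := by linarith [Nat.ceil_lt_add_one (zero_le_one.trans ht1)]
  have hb : g t ≤ ENNReal.ofReal (Real.exp (t * a)) := by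
    refine (hg (Nat.le_ceil t)).trans (ht.trans (ENNReal.ofReal_le_ofReal (Real.exp_le_exp.2 ?_)))
    calc 3 * (1 / ((k : ℝ) + 1)) * (⌈t⌉₊ : ℝ) ≤ 3 * (a / 6) * (2 * t) := by gcongr
      _ = t * a := by ring
  rw [EReal.div_le_iff_le_mul (by exact_mod_cast zero_lt_one.trans_le ht1) (EReal.coe_ne_top _)]
  refine (ENNReal.log_monotone hb).trans ?_
  rw [ENNReal.log_ofReal_of_pos (Real.exp_pos _), Real.log_exp]
  exact le_of_eq (EReal.coe_mul _ _)

theorem measurable_hurstWeight (H : ℝ) : Measurable fun q : ℝ × ℝ => hurstWeight H q.1 q.2 := by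
  unfold hurstWeight
  fun_prop

theorem monotone_weightedLocalTime {E : Type*} [Sub E] (H : ℝ) (f : E → ℝ≥0∞)
    (Y₁ Y₂ : ℝ≥0 → Ω → E) (ω : Ω) : Monotone fun t => weightedLocalTime H f Y₁ Y₂ t ω := by
  intro t t' h
  refine (lintegral_mono fun s => ?_).trans (lintegral_mono_set (Set.Ioc_subset_Ioc_right h))
  exact lintegral_mono_set (Set.Ioc_subset_Ioc_right h)

/-! ### First moment and almost sure bound of the local time -/

section WeightedLocalTime

variable {d : ℕ} {Ω : Type*} [MeasurableSpace Ω] {P : Measure Ω}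
  {f : EuclideanSpace ℝ (Fin d) → ℝ≥0∞} {Y₁ Y₂ : ℝ≥0 → Ω → EuclideanSpace ℝ (Fin d)}

theorem measurable_weightedLocalTime_integrand (H : ℝ) (hf : Measurable f)
    (h₁ : Measurable fun q : ℝ≥0 × Ω => Y₁ q.1 q.2)
    (h₂ : Measurable fun q : ℝ≥0 × Ω => Y₂ q.1 q.2) :
    Measurable fun q : (Ω × ℝ) × ℝ => hurstWeight H q.2 q.1.2 *
      f (Y₁ q.2.toNNReal q.1.1 - Y₂ q.1.2.toNNReal q.1.1) := by
  refine ((measurable_hurstWeight H).comp (by fun_prop :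
    Measurable fun q : (Ω × ℝ) × ℝ => (q.2, q.1.2))).mul (hf.comp (Measurable.sub ?_ ?_))
  · exact h₁.comp (by fun_prop : Measurable fun q : (Ω × ℝ) × ℝ => (q.2.toNNReal, q.1.1))
  · exact h₂.comp (by fun_prop : Measurable fun q : (Ω × ℝ) × ℝ => (q.1.2.toNNReal, q.1.1))

theorem measurable_weightedLocalTime (H : ℝ) (hf : Measurable f)
    (h₁ : Measurable fun q : ℝ≥0 × Ω => Y₁ q.1 q.2)
    (h₂ : Measurable fun q : ℝ≥0 × Ω => Y₂ q.1 q.2) (t : ℝ) :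
    Measurable (weightedLocalTime H f Y₁ Y₂ t) :=
  (measurable_weightedLocalTime_integrand H hf h₁ h₂).lintegral_prod_right'.lintegral_prod_right'

theorem lintegral_weightedLocalTime [SFinite P] (H : ℝ) (hf : Measurable f)
    (h₁ : Measurable fun q : ℝ≥0 × Ω => Y₁ q.1 q.2)
    (h₂ : Measurable fun q : ℝ≥0 × Ω => Y₂ q.1 q.2) (t : ℝ) :
    ∫⁻ ω, weightedLocalTime H f Y₁ Y₂ t ω ∂P =
      ∫⁻ s in Set.Ioc (0 : ℝ) t, ∫⁻ r in Set.Ioc (0 : ℝ) t,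
        hurstWeight H r s * ∫⁻ ω, f (Y₁ r.toNNReal ω - Y₂ s.toNNReal ω) ∂P := by
  have hm := measurable_weightedLocalTime_integrand H hf h₁ h₂
  unfold weightedLocalTime
  rw [lintegral_lintegral_swap hm.lintegral_prod_right'.aemeasurable]
  refine lintegral_congr fun s => ?_
  have hg : Measurable fun q : Ω × ℝ => ((q.1, s), q.2) := by fun_prop
  have hms := hm.comp hg
  simp only [Function.comp_def] at hms
  rw [lintegral_lintegral_swap (f := fun ω r =>
    hurstWeight H r s * f (Y₁ r.toNNReal ω - Y₂ s.toNNReal ω)) hms.aemeasurable]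
  exact lintegral_congr fun r => lintegral_const_mul' _ _ ENNReal.ofReal_ne_top

theorem lintegral_weightedLocalTime_le [SFinite P] {Ω' : Type*} [MeasurableSpace Ω']
    {P' : Measure Ω'} {H : ℝ} (hf : Measurable f) (h₁ : Measurable fun q : ℝ≥0 × Ω => Y₁ q.1 q.2)
    (h₂ : Measurable fun q : ℝ≥0 × Ω => Y₂ q.1 q.2)
    {Z : ℝ≥0 → Ω' → EuclideanSpace ℝ (Fin d)}
    (hle : ∀ r s : ℝ≥0, 0 < r → 0 < s →
      ∫⁻ ω, f (Y₁ r ω - Y₂ s ω) ∂P ≤ levySemigroup Z P' (r + s) f 0)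
    {a : ℝ} (ha : 0 < a) (t : ℝ) :
    ∫⁻ ω, weightedLocalTime H f Y₁ Y₂ t ω ∂P ≤
      ENNReal.ofReal (Real.exp (2 * a * t)) * fracResolvent Z P' H a f 0 := by
  rw [lintegral_weightedLocalTime H hf h₁ h₂]
  unfold fracResolvent
  simp_rw [← lintegral_const_mul' _ _ (ENNReal.ofReal_ne_top (r := Real.exp (2 * a * t)))]
  refine (setLIntegral_mono' measurableSet_Ioc fun s hs => ?_).trans
    (lintegral_mono_set Set.Ioc_subset_Ioi_self)
  refine (setLIntegral_mono' measurableSet_Ioc fun r hr => ?_).trans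
    (lintegral_mono_set Set.Ioc_subset_Ioi_self)
  -- Since r, s ≤ t, the factor e^{2at} pays for inserting the resolvent weight e^{-a(r+s)}.
  have h1 : 1 ≤ ENNReal.ofReal (Real.exp (2 * a * t)) *
      ENNReal.ofReal (Real.exp (-a * (r + s))) := by
    rw [← ENNReal.ofReal_mul (Real.exp_nonneg _), ← Real.exp_add, ENNReal.one_le_ofReal,
      Real.one_le_exp_iff]
    nlinarith [hs.2, hr.2]
  rw [Real.toNNReal_add hr.1.le hs.1.le]
  calc hurstWeight H r s * ∫⁻ ω, f (Y₁ r.toNNReal ω - Y₂ s.toNNReal ω) ∂P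
      ≤ 1 * (hurstWeight H r s * levySemigroup Z P' (r.toNNReal + s.toNNReal) f 0) := by
        rw [one_mul]
        gcongr
        exact hle _ _ (Real.toNNReal_pos.2 hr.1) (Real.toNNReal_pos.2 hs.1)
    _ ≤ ENNReal.ofReal (Real.exp (2 * a * t)) * ENNReal.ofReal (Real.exp (-a * (r + s))) *
        (hurstWeight H r s * levySemigroup Z P' (r.toNNReal + s.toNNReal) f 0) := by gcongr
    _ = _ := by ring

/-- The extra e^{-an} makes the expected sum geometric, so the terms e^{-3an} L_n tend to 0 almost
surely. -/
theorem ae_eventually_weightedLocalTime_le {H : ℝ} (hf : Measurable f)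
    (h₁ : Measurable fun q : ℝ≥0 × Ω => Y₁ q.1 q.2)
    (h₂ : Measurable fun q : ℝ≥0 × Ω => Y₂ q.1 q.2) {a : ℝ} (ha : 0 < a) {R : ℝ≥0∞} (hR : R < ∞)
    (hle : ∀ n : ℕ, ∫⁻ ω, weightedLocalTime H f Y₁ Y₂ n ω ∂P ≤
      ENNReal.ofReal (Real.exp (2 * a * n)) * R) :
    ∀ᵐ ω ∂P, ∀ᶠ n : ℕ in atTop,
      weightedLocalTime H f Y₁ Y₂ n ω ≤ ENNReal.ofReal (Real.exp (3 * a * n)) := by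
  have hW (n : ℕ) := measurable_weightedLocalTime H hf h₁ h₂ (n : ℝ)
  have hsum : ∫⁻ ω, ∑' n : ℕ, ENNReal.ofReal (Real.exp (-(3 * a * n))) *
      weightedLocalTime H f Y₁ Y₂ n ω ∂P ≠ ∞ := by
    rw [lintegral_tsum fun n => ((hW n).const_mul _).aemeasurable]
    have hn (n : ℕ) : ∫⁻ ω, ENNReal.ofReal (Real.exp (-(3 * a * n))) *
        weightedLocalTime H f Y₁ Y₂ n ω ∂P ≤ ENNReal.ofReal (Real.exp (-a) ^ n) * R := by
      rw [lintegral_const_mul _ (hW n)]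
      refine (mul_le_mul_right (hle n) _).trans (le_of_eq ?_)
      rw [← mul_assoc, ← ENNReal.ofReal_mul (Real.exp_nonneg _), ← Real.exp_add, ← Real.exp_nat_mul]
      congr 3
      ring
    refine ne_top_of_le_ne_top ?_ (ENNReal.tsum_le_tsum hn)
    rw [ENNReal.tsum_mul_right]
    refine ENNReal.mul_ne_top ?_ hR.ne
    exact (summable_geometric_of_lt_one (Real.exp_nonneg _)
      (Real.exp_lt_one_iff.2 (by linarith))).tsum_ofReal_ne_top
  have hae := ae_lt_top (Measurable.tsum fun n => (hW n).const_mul _) hsum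
  filter_upwards [hae] with ω hω
  filter_upwards [(ENNReal.tendsto_atTop_zero_of_tsum_ne_top hω.ne).eventually
    (eventually_le_nhds zero_lt_one)] with n hn
  calc weightedLocalTime H f Y₁ Y₂ n ω
      = ENNReal.ofReal (Real.exp (3 * a * n)) * (ENNReal.ofReal (Real.exp (-(3 * a * n))) *
          weightedLocalTime H f Y₁ Y₂ n ω) := by
        rw [← mul_assoc, ← ENNReal.ofReal_mul (Real.exp_nonneg _), ← Real.exp_add]
        simp
    _ ≤ ENNReal.ofReal (Real.exp (3 * a * n)) * 1 := by gcongr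
    _ = _ := mul_one _

end WeightedLocalTime

end IntersectionLocalTime

/-! ### Conclusion -/

open IntersectionLocalTime

theorem mainTheorem6 {d : ℕ} {Ω Ω' : Type*} [MeasurableSpace Ω] [MeasurableSpace Ω']
    (P : Measure Ω) [IsProbabilityMeasure P] (P' : Measure Ω') [IsProbabilityMeasure P']
    -- the Hurst index
    (H : ℝ) (hH : 1 / 2 < H) (hH1 : H < 1)
    -- the kernel `f` with spectral measure `μ`
    (f : EuclideanSpace ℝ (Fin d) → ℝ≥0∞) (μ : Measure (EuclideanSpace ℝ (Fin d)))
    (hf : IsCovarianceKernel f μ)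
    -- the Lévy process `X`, whose one-dimensional laws have densities
    (X : ℝ≥0 → Ω → EuclideanSpace ℝ (Fin d)) (hX : IsLevyProcess X P)
    (hXpdf : ∀ t : ℝ≥0, 0 < t → HasPDF (X t) P volume)
    -- an independent copy of `X`, and the symmetrization `Xbar = X - Xtilde`
    (Xtilde : ℝ≥0 → Ω → EuclideanSpace ℝ (Fin d)) (hXtilde : IsProcessCopy Xtilde P X P)
    (hXX : IndepProcesses X Xtilde P)
    (Xbar : ℝ≥0 → Ω → EuclideanSpace ℝ (Fin d)) (hXbar : ∀ t ω, Xbar t ω = X t ω - Xtilde t ω)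
    -- the two conditions of the theorem
    (hf0 : ∀ x, f x < ∞ ↔ x ≠ 0)
    (hres : ∀ a : ℝ, 0 < a → fracResolvent Xbar P H a f 0 < ∞)
    -- two independent copies of `Xbar`, started at `x₁` and `x₂`
    (x₁ x₂ : EuclideanSpace ℝ (Fin d))
    (Y₁ Y₂ : ℝ≥0 → Ω' → EuclideanSpace ℝ (Fin d))
    (hY₁ : IsProcessCopy Y₁ P' (fun t ω => x₁ + Xbar t ω) P)
    (hY₂ : IsProcessCopy Y₂ P' (fun t ω => x₂ + Xbar t ω) P)
    (hYY : IndepProcesses Y₁ Y₂ P') :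
    (∀ᵐ ω ∂P', ∀ t : ℝ, 0 < t → weightedLocalTime H f Y₁ Y₂ t ω < ∞) ∧
      (∀ᵐ ω ∂P',
        limsup (fun t : ℝ => ENNReal.log (weightedLocalTime H f Y₁ Y₂ t ω) / ((t : ℝ) : EReal))
          atTop ≤ 0) := by

  -- Tonelli needs joint measurability in (t, ω); the replacements agree with Y₁, Y₂ at all times
  -- simultaneously, almost surely, so the local time is unchanged.
  obtain ⟨Z₁, hZ₁, hZY₁⟩ := exists_measurable_uncurry_of_hasCadlagPaths hY₁.measurable hY₁.cadlag
  obtain ⟨Z₂, hZ₂, hZY₂⟩ := exists_measurable_uncurry_of_hasCadlagPaths hY₂.measurable hY₂.cadlag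
  have hfm := hf.measurable
  have hXbm (t) : Measurable (Xbar t) := by
    rw [funext (hXbar t)]
    exact (hX.measurable t).sub (hXtilde.measurable t)
  have hker (r s : ℝ≥0) (hr : 0 < r) (hs : 0 < s) :
      ∫⁻ ω, f (Z₁ r ω - Z₂ s ω) ∂P' ≤ levySemigroup Xbar P (r + s) f 0 := by
    have := hXpdf (r + s) (add_pos hr hs)
    refine le_trans (le_of_eq ?_)
      (levySemigroup_le hf hX.measurable hXtilde hXX hXbar (r + s) (x₁ - x₂))
    calc ∫⁻ ω, f (Z₁ r ω - Z₂ s ω) ∂P' = ∫⁻ ω, f (Y₁ r ω - Y₂ s ω) ∂P' := by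
          refine lintegral_congr_ae ?_
          filter_upwards [hZY₁, hZY₂] with ω h1 h2
          rw [h1, h2]
      _ = ∫⁻ y, f y ∂(P'.map fun ω => Y₁ r ω - Y₂ s ω) :=
          (lintegral_map hfm ((hY₁.measurable r).sub (hY₂.measurable s))).symm
      _ = levySemigroup Xbar P (r + s) f (x₁ - x₂) := by
          rw [map_sub_eq_map_symmetrization hX hXtilde hXX hXbar hY₁ hY₂ hYY,
            lintegral_map hfm ((hXbm _).const_add _)]
          rfl
  have hbound {a : ℝ} (ha : 0 < a) (n : ℕ) :=
    lintegral_weightedLocalTime_le (H := H) hfm hZ₁ hZ₂ hker ha (n : ℝ)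
  have hpos (k : ℕ) : 0 < 1 / ((k : ℝ) + 1) := by positivity
  have hev := ae_all_iff.2 fun k : ℕ => ae_eventually_weightedLocalTime_le hfm hZ₁ hZ₂ (hpos k)
    (hres _ (hpos k)) (hbound (hpos k))
  have hfin : ∀ᵐ ω ∂P', ∀ n : ℕ, weightedLocalTime H f Z₁ Z₂ n ω < ∞ := by
    refine ae_all_iff.2 fun n => ae_lt_top (measurable_weightedLocalTime H hfm hZ₁ hZ₂ n) ?_
    exact ((hbound zero_lt_one n).trans_lt
      (ENNReal.mul_lt_top ENNReal.ofReal_lt_top (hres 1 zero_lt_one))).ne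
  have heq : ∀ᵐ ω ∂P', ∀ t, weightedLocalTime H f Y₁ Y₂ t ω = weightedLocalTime H f Z₁ Z₂ t ω := by
    filter_upwards [hZY₁, hZY₂] with ω h1 h2 t
    simp only [weightedLocalTime, h1, h2]
  constructor
  · filter_upwards [hfin, heq] with ω h1 h2 t _
    rw [h2]
    exact (monotone_weightedLocalTime H f Z₁ Z₂ ω (Nat.le_ceil t)).trans_lt (h1 _)
  · filter_upwards [hev, heq] with ω h1 h2
    simp_rw [h2]
    exact limsup_log_div_le_zero (monotone_weightedLocalTime H f Z₁ Z₂ ω) h1
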